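/- For $n\in\mathbb N=\{0,1,2,\dots\}$ and $\beta\in\mathbb R$, consider on $(0,1)$ the eigenvalue problem \[ -f''-\frac1r f'+\Big(\frac nr-\frac{\beta}{2}r\Big)^2 f=\mu f\ \text{ in }(0,1),\qquad f'(1)=0,\qquad f(0)=0\ \text{ if } n>0,\qquad f'(0)=0\ \text{ if } n=0, \] where $\mu\in\mathbb R$ and $f:[0,1]\to\mathbb R$ is not identically zero, continuous on $[0,1]$ and of class $C^2$ on $(0,1)$, and the derivatives at the end points are one-sided. Let $\lambda(n,\beta)$ be its lowest eigenvalue. Then, for every $n\in\mathbb N$ and every $\beta>0$, the lowest eigenvalue $\lambda(n,\beta)$ exists and admits an eigenfunction $f_{n,\beta}$ that is positive on $(0,1)$ and normalized by $\int_0^1 f_{n,\beta}(r)^2\,r\,dr=1$; moreover, $\lambda(n,\cdot)$ is differentiable at $\beta$, and, for any such $f_{n,\beta}$, \[ \lambda'(n,\beta)=\frac{\lambda(n,\beta)}{\beta}-\frac1{2\beta}\Big(\lambda(n,\beta)-\big(n-\tfrac{\beta}{2}\big)^2\Big)\,|f_{n,\beta}(1)|^2 , \] where $'$ denotes the derivative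 with respect to $\beta$. -/

import Mathlib

namespace DiskNeumann

/-- `f` is an eigenfunction, with eigenvalue `μ`, of the operator
`H_{n,β} = -d²/dr² - (1/r) d/dr + (n/r - β r/2)²` on `(0,1)`, with the Dirichlet condition at `r = 0`
if `n > 0`, the Neumann condition at `r = 0` if `n = 0`, and the Neumann condition at `r = 1`.
Only the values of `f` on `[0,1]` matter; the derivatives at the end points are one-sided. -/
structure IsEigenfunction (n : ℕ) (β μ : ℝ) (f : ℝ → ℝ) : Prop where
  continuousOn : ContinuousOn f (Set.Icc 0 1)
  contDiffOn : ContDiffOn ℝ 2 f (Set.Ioo 0 1)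
  equation : ∀ r ∈ Set.Ioo (0 : ℝ) 1,
    -deriv (deriv f) r - (1 / r) * deriv f r + ((n : ℝ) / r - β / 2 * r) ^ 2 * f r = μ * f r
  dirichlet_zero : 0 < n → f 0 = 0
  neumann_zero : n = 0 → HasDerivWithinAt f 0 (Set.Icc 0 1) 0
  neumann_one : HasDerivWithinAt f 0 (Set.Icc 0 1) 1
  nontrivial : ∃ r ∈ Set.Icc (0 : ℝ) 1, f r ≠ 0

/-- The set of eigenvalues of `H_{n,β}`. -/
def eigenvalues (n : ℕ) (β : ℝ) : Set ℝ :=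
  {μ | ∃ f : ℝ → ℝ, IsEigenfunction n β μ f}

/-- `λ(n,β)`, the lowest eigenvalue of `H_{n,β}`. -/
noncomputable def lowestEigenvalue (n : ℕ) (β : ℝ) : ℝ :=
  sInf (eigenvalues n β)

/-- `f` is the positive eigenfunction associated with `λ(n,β)`, normalized in `L²((0,1), r dr)`. -/
structure IsGroundState (n : ℕ) (β : ℝ) (f : ℝ → ℝ) : Prop where
  eigenfunction : IsEigenfunction n β (lowestEigenvalue n β) f
  pos : ∀ r ∈ Set.Ioo (0 : ℝ) 1, 0 < f r
  normalized : ∫ r in (0 : ℝ)..1, f r ^ 2 * r = 1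

end DiskNeumann

/-! Write `V` for the potential. The solution `u` of the differential equation that is regular at
`0` is `r ^ n * exp (-b r² / 4)` times an entire function of `r²` (Kummer's function), so every `μ`
has an explicit candidate, jointly continuous in `(b, μ, r)`. It is an eigenfunction once it is
positive and its flux `r u'` vanishes at `1`.

Existence is by shooting in `μ`: the values for which `u` stays positive with positive flux at `1`
form a nonempty open set, bounded above. At its supremum positivity survives because Kummer's
function has no double zero, and the flux must vanish (`exists_kummer_pos`). Picone's identity then
compares any eigenfunction with `u`: no smaller eigenvalue exists, and the lowest one is simple
(`isLeast_eigenvalues`, `IsEigenfunction.eq_const_mul_radial`).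

For the derivative, the Wronskian of two ground states with parameters `b` and `b'` gives an exact
formula for the difference of the eigenvalues (`lowestEigenvalue_sub`). It yields continuity of the
eigenvalue, and then the Feynman–Hellmann formula `λ' = ∫ (-n + β r² / 2) f² r` for normalized `f`.
The virial identity (`virial_radial`) evaluates the moment `∫ r³ f²` in terms of `λ` and `f 1`,
which gives the stated formula. -/

namespace DiskNeumann

open Set Filter Topology

/-! ### Entire functions from exponential generating functions -/

/-- The exponential generating function of the sequence `c`. -/
noncomputable def egf (c : ℕ → ℝ) (t : ℝ) : ℝ :=
  ∑' k : ℕ, c k * (t ^ k / (k.factorial : ℝ))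

theorem norm_egf_term_le {c : ℕ → ℝ} {A K T : ℝ} (hc : ∀ k, |c k| ≤ A * K ^ k) {t : ℝ}
    (ht : |t| ≤ T) (k : ℕ) :
    ‖c k * (t ^ k / (k.factorial : ℝ))‖ ≤ A * ((K * T) ^ k / (k.factorial : ℝ)) := by
  have hk : (0 : ℝ) < k.factorial := by positivity
  rw [norm_mul, norm_div, norm_pow, Real.norm_eq_abs, Real.norm_eq_abs, Real.norm_eq_abs,
    abs_of_pos hk, mul_pow]
  calc |c k| * (|t| ^ k / k.factorial) ≤ (A * K ^ k) * (T ^ k / k.factorial) := by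
        gcongr
        · exact (abs_nonneg _).trans (hc k)
        · exact hc k
    _ = _ := by ring

theorem summable_egf_bound (A x : ℝ) :
    Summable fun k : ℕ => A * (x ^ k / (k.factorial : ℝ)) :=
  (Real.summable_pow_div_factorial x).mul_left A

theorem summable_egf {c : ℕ → ℝ} {A K : ℝ} (hc : ∀ k, |c k| ≤ A * K ^ k) (t : ℝ) :
    Summable fun k : ℕ => c k * (t ^ k / (k.factorial : ℝ)) :=
  Summable.of_norm_bounded (summable_egf_bound A (K * |t|))
    fun k => norm_egf_term_le hc le_rfl k

theorem abs_shift_le {c : ℕ → ℝ} {A K : ℝ} (hc : ∀ k, |c k| ≤ A * K ^ k) (k : ℕ) :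
    |c (k + 1)| ≤ A * K * K ^ k :=
  (hc (k + 1)).trans_eq (by ring)

theorem pow_succ_div_factorial (t : ℝ) (k : ℕ) :
    ((k : ℝ) + 1) * (t ^ (k + 1) / ((k + 1).factorial : ℝ)) = t * (t ^ k / (k.factorial : ℝ)) := by
  have hk : (k.factorial : ℝ) ≠ 0 := by positivity
  rw [Nat.factorial_succ]
  push_cast
  field_simp
  ring

/-- Differentiating an exponential generating function shifts its sequence. -/
theorem hasDerivAt_egf {c : ℕ → ℝ} {A K : ℝ} (hc : ∀ k, |c k| ≤ A * K ^ k) (t : ℝ) :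
    HasDerivAt (egf c) (egf (fun k => c (k + 1)) t) t := by
  let g' : ℕ → ℝ → ℝ := fun k y => c k * ((k : ℝ) * y ^ (k - 1) / (k.factorial : ℝ))
  have hg'_succ : ∀ k y, g' (k + 1) y = c (k + 1) * (y ^ k / (k.factorial : ℝ)) := by
    intro k y
    have hk : (k.factorial : ℝ) ≠ 0 := by positivity
    simp only [g', Nat.factorial_succ, Nat.add_sub_cancel]
    push_cast
    field_simp
  -- The constant term has zero derivative, so the majorant starts with `0` and is the exponential
  -- series shifted by one.
  let B : ℕ → ℝ := fun k => Nat.casesOn k 0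
    fun j => A * K * ((K * (|t| + 1)) ^ j / (j.factorial : ℝ))
  have hB : Summable B := by
    rw [← summable_nat_add_iff 1]
    exact summable_egf_bound (A * K) (K * (|t| + 1))
  have hbound : ∀ k, ∀ y ∈ Metric.ball (0 : ℝ) (|t| + 1), ‖g' k y‖ ≤ B k := by
    intro k y hy
    rw [mem_ball_zero_iff, Real.norm_eq_abs] at hy
    cases k with
    | zero => simp [g', B]
    | succ j =>
      rw [hg'_succ]
      exact norm_egf_term_le (abs_shift_le hc) hy.le j
  have hmem : t ∈ Metric.ball (0 : ℝ) (|t| + 1) := by simp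
  have key := hasDerivAt_tsum_of_isPreconnected (𝕜 := ℝ) (F := ℝ)
    (g := fun k y => c k * (y ^ k / (k.factorial : ℝ))) (g' := g') hB Metric.isOpen_ball
    (convex_ball (0 : ℝ) (|t| + 1)).isPreconnected
    (fun k y _ => ((hasDerivAt_pow k y).div_const _).const_mul _) hbound hmem
    (summable_egf hc t) hmem
  have hs : Summable fun k => g' k t :=
    Summable.of_norm_bounded hB fun k => hbound k t hmem
  rw [hs.tsum_eq_zero_add] at key
  simp only [hg'_succ] at key
  have hg0 : g' 0 t = 0 := by simp [g']
  rw [hg0, zero_add] at key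
  exact key

theorem contDiff_egf (m : ℕ) {c : ℕ → ℝ} {A K : ℝ} (hc : ∀ k, |c k| ≤ A * K ^ k) :
    ContDiff ℝ m (egf c) := by
  induction m generalizing c A with
  | zero =>
    exact contDiff_zero.2 (continuous_iff_continuousAt.2 fun t => (hasDerivAt_egf hc t).continuousAt)
  | succ m ih =>
    have hd : deriv (egf c) = egf fun k => c (k + 1) := funext fun t => (hasDerivAt_egf hc t).deriv
    push_cast
    rw [contDiff_succ_iff_deriv]
    refine ⟨fun t => (hasDerivAt_egf hc t).differentiableAt, by simp, ?_⟩
    rw [hd]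
    exact ih (abs_shift_le hc)

theorem mul_egf_shift {c : ℕ → ℝ} {A K : ℝ} (hc : ∀ k, |c k| ≤ A * K ^ k) (t : ℝ) :
    HasSum (fun k : ℕ => (k : ℝ) * c k * (t ^ k / (k.factorial : ℝ)))
      (t * egf (fun k => c (k + 1)) t) := by
  have h := ((summable_egf (abs_shift_le hc) t).hasSum.mul_left t)
  have h' : HasSum (fun k : ℕ => ((k + 1 : ℕ) : ℝ) * c (k + 1) *
      (t ^ (k + 1) / ((k + 1).factorial : ℝ))) (t * egf (fun k => c (k + 1)) t) := by
    have e : ∀ k : ℕ, ((k + 1 : ℕ) : ℝ) * c (k + 1) * (t ^ (k + 1) / ((k + 1).factorial : ℝ)) =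
        t * (c (k + 1) * (t ^ k / (k.factorial : ℝ))) := fun k => by
      rw [Nat.cast_add_one, mul_right_comm, pow_succ_div_factorial]
      ring
    simp only [e]
    exact h
  have := (hasSum_nat_add_iff (f := fun k : ℕ => (k : ℝ) * c k * (t ^ k / (k.factorial : ℝ))) 1).1 h'
  simpa using this

/-- Near a given point the geometric bounds are dominated by fixed ones, so the series converges
uniformly there. This lets the parameters `(b, μ)` vary together with `t`. -/
theorem continuous_egf_param {X : Type*} [TopologicalSpace X] {c : X → ℕ → ℝ} {A K : X → ℝ}
    (hA : Continuous A) (hK : Continuous K) (hK0 : ∀ x, 0 ≤ K x)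
    (hcont : ∀ k, Continuous fun x => c x k) (hc : ∀ x k, |c x k| ≤ A x * K x ^ k) :
    Continuous fun p : X × ℝ => egf (c p.1) p.2 := by
  rw [continuous_iff_continuousAt]
  rintro ⟨x₀, t₀⟩
  let s : Set (X × ℝ) := {p | A p.1 < A x₀ + 1 ∧ K p.1 < K x₀ + 1 ∧ |p.2| < |t₀| + 1}
  have hs : IsOpen s :=
    (isOpen_lt (hA.comp continuous_fst) continuous_const).inter
      ((isOpen_lt (hK.comp continuous_fst) continuous_const).inter
        (isOpen_lt continuous_snd.abs continuous_const))
  have hmem : (x₀, t₀) ∈ s := by simp [s]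
  refine ContinuousOn.continuousAt (s := s) ?_ (hs.mem_nhds hmem)
  refine continuousOn_tsum (fun k => ?_)
    (summable_egf_bound (A x₀ + 1) ((K x₀ + 1) * (|t₀| + 1))) ?_
  · exact Continuous.continuousOn (((hcont k).comp continuous_fst).mul (by fun_prop))
  · rintro k ⟨x, t⟩ ⟨h1, h2, h3⟩
    refine norm_egf_term_le (fun j => (hc x j).trans ?_) h3.le k
    have hA0 : 0 ≤ A x := by simpa using (abs_nonneg _).trans (hc x 0)
    have := hK0 x
    dsimp only at h1 h2
    have : 0 ≤ A x₀ + 1 := hA0.trans h1.le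
    gcongr

/-! ### Kummer's function and its equation -/

/-- The coefficients of Kummer's function `M(1/2 - μ/(2b), n + 1, b t / 2)`. -/
noncomputable def kummerCoeff (n : ℕ) (b μ : ℝ) (k : ℕ) : ℝ :=
  ∏ j ∈ Finset.range k, (b * (1 + 2 * j) - μ) / (4 * (n + 1 + j))

theorem kummerCoeff_zero (n : ℕ) (b μ : ℝ) : kummerCoeff n b μ 0 = 1 := by
  simp [kummerCoeff]

theorem kummerCoeff_succ (n : ℕ) (b μ : ℝ) (k : ℕ) :
    ((n : ℝ) + 1 + k) * kummerCoeff n b μ (k + 1) =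
      (b * (1 + 2 * k) - μ) / 4 * kummerCoeff n b μ k := by
  have h : (n : ℝ) + 1 + k ≠ 0 := by positivity
  rw [kummerCoeff, kummerCoeff, Finset.prod_range_succ]
  field_simp

/-- Each factor of the product is at most `|b| + |μ|` in absolute value, since `1 + 2 * j ≤ 4 * (n +
1 + j)`. -/
theorem abs_kummerCoeff_le (n : ℕ) (b μ : ℝ) (k : ℕ) :
    |kummerCoeff n b μ k| ≤ 1 * (|b| + |μ|) ^ k := by
  rw [kummerCoeff, Finset.abs_prod, one_mul]
  refine (Finset.prod_le_prod (g := fun _ => |b| + |μ|) (fun j _ => abs_nonneg _)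
    fun j _ => ?_).trans_eq (by simp)
  have h : (0 : ℝ) < 4 * (n + 1 + j) := by positivity
  rw [abs_div, abs_of_pos h, div_le_iff₀ h]
  have h1 : |b * (1 + 2 * (j : ℝ)) - μ| ≤ |b| * (1 + 2 * j) + |μ| := by
    have h2 : |b * (1 + 2 * (j : ℝ))| = |b| * (1 + 2 * j) := by
      rw [abs_mul, abs_of_pos (by positivity : (0 : ℝ) < 1 + 2 * j)]
    rw [← h2]
    exact norm_sub_le (b * (1 + 2 * (j : ℝ))) μ
  have hn : (0 : ℝ) ≤ n := by positivity
  have hj : (0 : ℝ) ≤ j := by positivity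
  nlinarith [abs_nonneg b, abs_nonneg μ, mul_nonneg (abs_nonneg b) hn,
    mul_nonneg (abs_nonneg b) hj, mul_nonneg (abs_nonneg μ) hn, mul_nonneg (abs_nonneg μ) hj]

/-- Kummer's function `M(1/2 - μ/(2b), n + 1, b t / 2)` as a function of `t`. -/
noncomputable def kummer (n : ℕ) (b μ t : ℝ) : ℝ :=
  egf (kummerCoeff n b μ) t

/-- The derivative of `kummer` in `t`. -/
noncomputable def kummerDeriv (n : ℕ) (b μ t : ℝ) : ℝ :=
  egf (fun k => kummerCoeff n b μ (k + 1)) t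

/-- The second derivative of `kummer` in `t`. -/
noncomputable def kummerDeriv₂ (n : ℕ) (b μ t : ℝ) : ℝ :=
  egf (fun k => kummerCoeff n b μ (k + 2)) t

theorem hasDerivAt_kummer (n : ℕ) (b μ t : ℝ) :
    HasDerivAt (kummer n b μ) (kummerDeriv n b μ t) t :=
  hasDerivAt_egf (abs_kummerCoeff_le n b μ) t

theorem hasDerivAt_kummerDeriv (n : ℕ) (b μ t : ℝ) :
    HasDerivAt (kummerDeriv n b μ) (kummerDeriv₂ n b μ t) t :=
  hasDerivAt_egf (abs_shift_le (abs_kummerCoeff_le n b μ)) t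

theorem contDiff_kummer (n m : ℕ) (b μ : ℝ) : ContDiff ℝ m (kummer n b μ) :=
  contDiff_egf m (abs_kummerCoeff_le n b μ)

theorem kummer_zero (n : ℕ) (b μ : ℝ) : kummer n b μ 0 = 1 := by
  rw [kummer, egf, tsum_eq_single 0 fun k hk => by simp [hk]]
  simp [kummerCoeff_zero]

theorem kummer_equation (n : ℕ) (b μ t : ℝ) :
    t * kummerDeriv₂ n b μ t + (n + 1 - b / 2 * t) * kummerDeriv n b μ t
      - (b - μ) / 4 * kummer n b μ t = 0 := by
  have hc := abs_kummerCoeff_le n b μ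
  have h1 := mul_egf_shift (abs_shift_le hc) t
  have h2 := mul_egf_shift hc t
  have h3 := (summable_egf (abs_shift_le hc) t).hasSum
  have h4 := (summable_egf hc t).hasSum
  have h5 := ((h1.add (h3.mul_left ((n : ℝ) + 1))).sub (h2.mul_left (b / 2))).sub
    (h4.mul_left ((b - μ) / 4))
  have h6 : t * kummerDeriv₂ n b μ t + ((n : ℝ) + 1) * kummerDeriv n b μ t
      - b / 2 * (t * kummerDeriv n b μ t) - (b - μ) / 4 * kummer n b μ t = 0 := by
    refine h5.unique ?_
    convert hasSum_zero with k
    linear_combination (t ^ k / (k.factorial : ℝ)) * kummerCoeff_succ n b μ k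
  linarith

theorem continuous_kummerCoeff (n k : ℕ) :
    Continuous fun p : ℝ × ℝ => kummerCoeff n p.1 p.2 k := by
  unfold kummerCoeff
  fun_prop

theorem continuous_kummer (n : ℕ) :
    Continuous fun p : (ℝ × ℝ) × ℝ => kummer n p.1.1 p.1.2 p.2 :=
  continuous_egf_param (A := fun _ => 1) (K := fun p : ℝ × ℝ => |p.1| + |p.2|)
    (by fun_prop) (by fun_prop) (fun _ => by positivity) (continuous_kummerCoeff n)
    fun p => abs_kummerCoeff_le n p.1 p.2

theorem continuous_kummerDeriv (n : ℕ) :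
    Continuous fun p : (ℝ × ℝ) × ℝ => kummerDeriv n p.1.1 p.1.2 p.2 :=
  continuous_egf_param (A := fun p : ℝ × ℝ => 1 * (|p.1| + |p.2|))
    (K := fun p : ℝ × ℝ => |p.1| + |p.2|)
    (by fun_prop) (by fun_prop) (fun _ => by positivity) (fun k => continuous_kummerCoeff n (k + 1))
    fun p => abs_shift_le (abs_kummerCoeff_le n p.1 p.2)

/-- Kummer's function has no double zero on the positive half-line. -/
theorem kummer_ne_zero_or_kummerDeriv_ne_zero (n : ℕ) (b μ : ℝ) {t : ℝ} (ht : 0 < t) :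
    kummer n b μ t ≠ 0 ∨ kummerDeriv n b μ t ≠ 0 := by
  by_contra! h
  obtain ⟨h0, h1⟩ := h
  have hzero : ∀ s ∈ Ioo 0 t, kummer n b μ s = 0 := by
    intro s hs
    -- A Grönwall argument run backwards from `t`. The equation is singular at `0`, so the rate
    -- depends on `s`: `1` absorbs the cross term `2 w w'`, `|b - μ| / (4 s)` the zeroth-order
    -- coefficient, and `|b|` and `(n + 1) / s` the two parts of the first-order coefficient. The
    -- weighted energy `E` increases on `[s, t]` and vanishes at `t`.
    let C : ℝ := 1 + |b - μ| / (4 * s) + |b|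
    let E : ℝ → ℝ := fun x =>
      (kummer n b μ x ^ 2 + kummerDeriv n b μ x ^ 2) * Real.exp (2 * ((n + 1) / s + C) * x)
    have hE : ∀ x, HasDerivAt E
        ((2 * kummer n b μ x * kummerDeriv n b μ x + 2 * kummerDeriv n b μ x * kummerDeriv₂ n b μ x)
          * Real.exp (2 * ((n + 1) / s + C) * x)
          + (kummer n b μ x ^ 2 + kummerDeriv n b μ x ^ 2) *
            (Real.exp (2 * ((n + 1) / s + C) * x) * (2 * ((n + 1) / s + C)))) x := by
      intro x
      have ha := ((hasDerivAt_kummer n b μ x).pow 2).add ((hasDerivAt_kummerDeriv n b μ x).pow 2)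
      have hb := ((hasDerivAt_id x).const_mul (2 * ((n + 1) / s + C))).exp
      refine (ha.mul hb).congr_deriv ?_
      simp
    have hmono : MonotoneOn E (Icc s t) := by
      refine monotoneOn_of_deriv_nonneg (convex_Icc s t)
        (fun x _ => (hE x).continuousAt.continuousWithinAt)
        (fun x _ => (hE x).differentiableAt.differentiableWithinAt) fun x hx => ?_
      rw [interior_Icc] at hx
      rw [(hE x).deriv]
      have hx0 : 0 < x := hs.1.trans hx.1
      set w := kummer n b μ x
      set w' := kummerDeriv n b μ x
      have heq := kummer_equation n b μ x
      have hw2 : kummerDeriv₂ n b μ x = (b - μ) / (4 * x) * w - ((n + 1) / x - b / 2) * w' := by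
        field_simp
        simp only [w, w']
        linear_combination 8 * heq
      rw [hw2]
      have e1 : (n + 1) / x ≤ ((n : ℝ) + 1) / s := by gcongr; exacts [hs.1, hx.1.le]
      have e2 : |(b - μ) / (4 * x)| ≤ |b - μ| / (4 * s) := by
        rw [abs_div, abs_of_pos (by positivity : 0 < 4 * x)]
        gcongr
        exacts [mul_pos four_pos hs.1, hx.1.le]
      have e3 : |b / 2| ≤ |b| := by rw [abs_div, abs_two]; linarith [abs_nonneg b]
      have e4 := abs_le.1 e2
      have e5 := abs_le.1 e3
      have e0 : 0 ≤ ((n : ℝ) + 1) / x := by positivity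
      have key : 0 ≤ (2 * w * w' + 2 * w' * ((b - μ) / (4 * x) * w - ((n + 1) / x - b / 2) * w'))
          + (w ^ 2 + w' ^ 2) * (2 * ((n + 1) / s + C)) := by
        have k1 : 0 ≤ 2 * w * w' + (w ^ 2 + w' ^ 2) := by nlinarith [sq_nonneg (w + w')]
        have k2 : 0 ≤ (b - μ) / (4 * x) * (2 * w' * w)
            + |b - μ| / (4 * s) * (w ^ 2 + w' ^ 2) := by
          nlinarith [sq_nonneg (w + w'), sq_nonneg (w - w')]
        have k3 : 0 ≤ (((n : ℝ) + 1) / s - (n + 1) / x) * w' ^ 2 :=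
          mul_nonneg (by linarith) (sq_nonneg _)
        have k4 : 0 ≤ (|b| + b / 2) * w' ^ 2 := mul_nonneg (by linarith) (sq_nonneg _)
        have k5 : 0 ≤ |b - μ| / (4 * s) := (abs_nonneg _).trans e2
        have k6 : 0 ≤ ((n : ℝ) + 1) / s := e0.trans e1
        simp only [C]
        nlinarith [sq_nonneg w, sq_nonneg w', mul_nonneg k5 (sq_nonneg w),
          mul_nonneg k5 (sq_nonneg w'), mul_nonneg k6 (sq_nonneg w), mul_nonneg k6 (sq_nonneg w'),
          mul_nonneg (abs_nonneg b) (sq_nonneg w), mul_nonneg (abs_nonneg b) (sq_nonneg w')]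
      have := mul_nonneg key (Real.exp_pos (2 * ((n + 1) / s + C) * x)).le
      linarith
    have hle := hmono (left_mem_Icc.2 hs.2.le) (right_mem_Icc.2 hs.2.le) hs.2.le
    simp only [E, h0, h1] at hle
    have hexp := Real.exp_pos (2 * ((n + 1) / s + C) * s)
    by_contra hne
    have : 0 < kummer n b μ s ^ 2 + kummerDeriv n b μ s ^ 2 := by positivity
    have := mul_pos this hexp
    linarith
  have hlim : Tendsto (kummer n b μ) (𝓝[>] 0) (𝓝 1) := by
    rw [← kummer_zero n b μ]
    exact (hasDerivAt_kummer n b μ 0).continuousAt.tendsto.mono_left nhdsWithin_le_nhds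
  have hlim0 : Tendsto (kummer n b μ) (𝓝[>] 0) (𝓝 0) :=
    tendsto_const_nhds.congr' (by
      filter_upwards [Ioo_mem_nhdsGT ht] with s hs using (hzero s hs).symm)
  exact one_ne_zero (tendsto_nhds_unique hlim hlim0)

/-! ### The regular radial solution -/

/-- The factor `r ^ n * exp (-b r² / 4)` of the regular solution. -/
noncomputable def gauge (n : ℕ) (b r : ℝ) : ℝ :=
  r ^ n * Real.exp (-(b / 4 * r ^ 2))

/-- The solution of `H_{n,b} u = μ u` that is regular at the origin. -/
noncomputable def radial (n : ℕ) (b μ r : ℝ) : ℝ :=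
  gauge n b r * kummer n b μ (r ^ 2)

/-- The flux `r u'(r)` of the regular solution `u`. -/
noncomputable def radialFlux (n : ℕ) (b μ r : ℝ) : ℝ :=
  gauge n b r * ((n - b / 2 * r ^ 2) * kummer n b μ (r ^ 2)
    + 2 * r ^ 2 * kummerDeriv n b μ (r ^ 2))

/-- The potential of `H_{n,b}`. -/
noncomputable def potential (n : ℕ) (b r : ℝ) : ℝ :=
  ((n : ℝ) / r - b / 2 * r) ^ 2

theorem gauge_pos (n : ℕ) (b : ℝ) {r : ℝ} (hr : 0 < r) : 0 < gauge n b r := by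
  unfold gauge; positivity

theorem hasDerivAt_gauge (n : ℕ) (b : ℝ) {r : ℝ} (hr : r ≠ 0) :
    HasDerivAt (gauge n b) (gauge n b r * (n / r - b / 2 * r)) r := by
  have h1 : HasDerivAt (fun r : ℝ => r ^ n) (n * (r ^ n / r)) r := by
    refine (hasDerivAt_pow n r).congr_deriv ?_
    cases n with
    | zero => simp
    | succ m => field_simp; simp [pow_succ]
  have h2 := (((hasDerivAt_pow 2 r).const_mul (b / 4)).neg).exp
  refine (h1.mul h2).congr_deriv ?_
  simp only [gauge, Pi.neg_apply, Nat.cast_ofNat, Nat.add_one_sub_one, pow_one]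
  field_simp
  ring

theorem hasDerivAt_comp_sq {F : ℝ → ℝ} {F' r : ℝ} (h : HasDerivAt F F' (r ^ 2)) :
    HasDerivAt (fun x => F (x ^ 2)) (F' * (2 * r)) r := by
  have := HasDerivAt.comp (h₂ := F) (h := fun x => x ^ 2) r h (hasDerivAt_pow 2 r)
  simpa [Function.comp_def] using this

theorem hasDerivAt_radial (n : ℕ) (b μ : ℝ) {r : ℝ} (hr : r ≠ 0) :
    HasDerivAt (radial n b μ) (radialFlux n b μ r / r) r := by
  refine ((hasDerivAt_gauge n b hr).mul
    (hasDerivAt_comp_sq (hasDerivAt_kummer n b μ (r ^ 2)))).congr_deriv ?_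
  unfold radialFlux
  field_simp

/-- This is the eigenvalue equation in divergence form `(r u')' = r (V - μ) u`; the gauge factor
turns it into Kummer's equation at `r ^ 2`. -/
theorem hasDerivAt_radialFlux (n : ℕ) (b μ : ℝ) {r : ℝ} (hr : r ≠ 0) :
    HasDerivAt (radialFlux n b μ) (r * (potential n b r - μ) * radial n b μ r) r := by
  have hp : HasDerivAt (fun x : ℝ => n - b / 2 * x ^ 2) (-(b / 2 * (2 * r))) r := by
    simpa using ((hasDerivAt_pow 2 r).const_mul (b / 2)).const_sub (n : ℝ)
  have hq : HasDerivAt (fun x : ℝ => 2 * x ^ 2) (2 * (2 * r)) r := by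
    simpa using (hasDerivAt_pow 2 r).const_mul (2 : ℝ)
  have h0 := hasDerivAt_comp_sq (hasDerivAt_kummer n b μ (r ^ 2))
  have h1 := hasDerivAt_comp_sq (hasDerivAt_kummerDeriv n b μ (r ^ 2))
  refine ((hasDerivAt_gauge n b hr).mul ((hp.mul h0).add (hq.mul h1))).congr_deriv ?_
  have heq := kummer_equation n b μ (r ^ 2)
  simp only [radial, potential, Pi.add_apply, Pi.mul_apply]
  field_simp
  linear_combination 16 * r ^ 2 * gauge n b r * heq

theorem continuous_radial (n : ℕ) :
    Continuous fun p : (ℝ × ℝ) × ℝ => radial n p.1.1 p.1.2 p.2 := by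
  have h := (continuous_kummer n).comp
    (by fun_prop : Continuous fun p : (ℝ × ℝ) × ℝ => (p.1, p.2 ^ 2))
  have hg : Continuous fun p : (ℝ × ℝ) × ℝ => gauge n p.1.1 p.2 := by
    unfold gauge; fun_prop
  exact hg.mul h

theorem continuous_radialFlux (n : ℕ) :
    Continuous fun p : (ℝ × ℝ) × ℝ => radialFlux n p.1.1 p.1.2 p.2 := by
  have h := (continuous_kummer n).comp
    (by fun_prop : Continuous fun p : (ℝ × ℝ) × ℝ => (p.1, p.2 ^ 2))
  have h' := (continuous_kummerDeriv n).comp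
    (by fun_prop : Continuous fun p : (ℝ × ℝ) × ℝ => (p.1, p.2 ^ 2))
  have hg : Continuous fun p : (ℝ × ℝ) × ℝ => gauge n p.1.1 p.2 := by
    unfold gauge; fun_prop
  exact hg.mul (((by fun_prop : Continuous fun p : (ℝ × ℝ) × ℝ =>
    (n : ℝ) - p.1.1 / 2 * p.2 ^ 2).mul h).add ((by fun_prop : Continuous fun p : (ℝ × ℝ) × ℝ =>
    2 * p.2 ^ 2).mul h'))

theorem continuous_radial_right (n : ℕ) (b μ : ℝ) : Continuous (radial n b μ) :=
  (continuous_radial n).comp (by fun_prop : Continuous fun r : ℝ => ((b, μ), r))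

theorem continuous_radialFlux_right (n : ℕ) (b μ : ℝ) : Continuous (radialFlux n b μ) :=
  (continuous_radialFlux n).comp (by fun_prop : Continuous fun r : ℝ => ((b, μ), r))

theorem radialFlux_zero (n : ℕ) (b μ : ℝ) : radialFlux n b μ 0 = 0 := by
  cases n <;> simp [radialFlux, gauge]

theorem contDiff_radial (n : ℕ) (b μ : ℝ) : ContDiff ℝ 2 (radial n b μ) := by
  have h := (contDiff_kummer n 2 b μ).comp (contDiff_id.pow 2)
  have hg : ContDiff ℝ 2 (gauge n b) := by unfold gauge; fun_prop
  exact hg.mul h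

theorem radial_pos {n : ℕ} {b μ r : ℝ} (hr : 0 < r) (h : 0 < kummer n b μ (r ^ 2)) :
    0 < radial n b μ r :=
  mul_pos (gauge_pos n b hr) h

/-- The regular solution satisfies the boundary value problem as soon as its flux vanishes at `1`. -/
theorem isEigenfunction_radial {n : ℕ} {b μ : ℝ} (h1 : radialFlux n b μ 1 = 0)
    (hpos : ∀ t ∈ Icc (0 : ℝ) 1, 0 < kummer n b μ t) :
    IsEigenfunction n b μ (radial n b μ) where
  continuousOn := (continuous_radial_right n b μ).continuousOn
  contDiffOn := (contDiff_radial n b μ).contDiffOn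
  equation := by
    intro r hr
    have hr0 : r ≠ 0 := hr.1.ne'
    have hd : deriv (radial n b μ) =ᶠ[𝓝 r] fun x => radialFlux n b μ x / x := by
      filter_upwards [isOpen_ne.mem_nhds hr0] with x hx using (hasDerivAt_radial n b μ hx).deriv
    have hdd : HasDerivAt (fun x => radialFlux n b μ x / x)
        ((r * (potential n b r - μ) * radial n b μ r * r - radialFlux n b μ r * 1) / r ^ 2) r :=
      (hasDerivAt_radialFlux n b μ hr0).div (hasDerivAt_id r) hr0
    rw [hd.deriv_eq, hdd.deriv, hd.eq_of_nhds]
    unfold potential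
    field_simp
    ring
  dirichlet_zero := fun hn => by simp [radial, gauge, hn.ne']
  neumann_zero := by
    rintro rfl
    have h0 := hasDerivAt_comp_sq (hasDerivAt_kummer 0 b μ (0 ^ 2))
    have h2 := (((hasDerivAt_pow 2 (0 : ℝ)).const_mul (b / 4)).neg).exp
    have h3 : HasDerivAt (radial 0 b μ) 0 0 := by
      have e : radial 0 b μ = fun x => Real.exp (-(b / 4 * x ^ 2)) * kummer 0 b μ (x ^ 2) := by
        funext x
        simp [radial, gauge]
      rw [e]
      refine (h2.mul h0).congr_deriv ?_
      simp
    exact h3.hasDerivWithinAt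
  neumann_one := by
    have := hasDerivAt_radial n b μ one_ne_zero
    rw [h1, zero_div] at this
    exact this.hasDerivWithinAt
  nontrivial := ⟨1, by simp, (radial_pos one_pos (by simpa using hpos 1 (by simp))).ne'⟩

/-! ### The Wronskian identity -/

/-- The inverse-square terms of the two potentials cancel, leaving the difference `(b - b') * (-n +
(b + b') / 4 * r ^ 2)`. -/
theorem hasDerivAt_wronskian (n : ℕ) (b μ b' μ' : ℝ) {r : ℝ} (hr : r ≠ 0) :
    HasDerivAt (fun r => radialFlux n b μ r * radial n b' μ' r
        - radialFlux n b' μ' r * radial n b μ r)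
      (((b - b') * (-n + (b + b') / 4 * r ^ 2) - (μ - μ')) *
        (radial n b μ r * radial n b' μ' r * r)) r := by
  refine (((hasDerivAt_radialFlux n b μ hr).mul (hasDerivAt_radial n b' μ' hr)).sub
    ((hasDerivAt_radialFlux n b' μ' hr).mul (hasDerivAt_radial n b μ hr))).congr_deriv ?_
  unfold potential
  field_simp
  ring

theorem integral_wronskian (n : ℕ) (b μ b' μ' : ℝ) :
    ∫ r in (0 : ℝ)..1, ((b - b') * (-n + (b + b') / 4 * r ^ 2) - (μ - μ')) *
        (radial n b μ r * radial n b' μ' r * r) =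
      radialFlux n b μ 1 * radial n b' μ' 1 - radialFlux n b' μ' 1 * radial n b μ 1 := by
  have hu := continuous_radial_right n b μ
  have hu' := continuous_radial_right n b' μ'
  have hP := continuous_radialFlux_right n b μ
  have hP' := continuous_radialFlux_right n b' μ'
  rw [intervalIntegral.integral_eq_sub_of_hasDerivAt_of_le zero_le_one
    ((hP.mul hu').sub (hP'.mul hu)).continuousOn
    (fun r hr => hasDerivAt_wronskian n b μ b' μ' hr.1.ne')
    (Continuous.intervalIntegrable (by fun_prop) 0 1)]
  simp [radialFlux_zero]

/-! ### Existence of a positive eigenfunction by shooting -/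

theorem kummer_ground (n : ℕ) (b t : ℝ) : kummer n b b t = 1 := by
  rw [kummer, egf, tsum_eq_single 0]
  · simp [kummerCoeff_zero]
  · intro k hk
    have : kummerCoeff n b b k = 0 :=
      Finset.prod_eq_zero (Finset.mem_range.2 (Nat.pos_of_ne_zero hk)) (by simp)
    simp [this]

theorem kummerDeriv_ground (n : ℕ) (b t : ℝ) : kummerDeriv n b b t = 0 := by
  have h := hasDerivAt_kummer n b b t
  rw [show kummer n b b = fun _ => 1 from funext (kummer_ground n b)] at h
  exact h.unique (hasDerivAt_const t 1)

/-- Values of `μ` for which the regular solution is positive with positive flux at `1`. -/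
def subcritical (n : ℕ) (b : ℝ) : Set ℝ :=
  {μ | (∀ t ∈ Icc (0 : ℝ) 1, 0 < kummer n b μ t) ∧ 0 < radialFlux n b μ 1}

theorem isOpen_subcritical (n : ℕ) (b : ℝ) : IsOpen (subcritical n b) := by
  have h1 : IsOpen {μ | ∀ t ∈ Icc (0 : ℝ) 1, 0 < kummer n b μ t} := by
    rw [isOpen_iff_mem_nhds]
    intro μ hμ
    have hc : Continuous fun p : ℝ × ℝ => kummer n b p.1 p.2 :=
      (continuous_kummer n).comp (by fun_prop : Continuous fun p : ℝ × ℝ => ((b, p.1), p.2))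
    exact isCompact_Icc.eventually_forall_of_forall_eventually fun t ht =>
      hc.continuousAt.eventually_const_lt (hμ t ht)
  exact h1.inter (isOpen_lt continuous_const ((continuous_radialFlux n).comp
    (by fun_prop : Continuous fun μ : ℝ => ((b, μ), (1 : ℝ)))))

/-- The comparison solution at `b' = μ' = 2 n` is `r ^ n * exp (-n r² / 2)`, positive on `(0, 1]`
with zero flux at `1`. For `μ` above the bound the Wronskian integrand would be nonpositive, while
the boundary term is positive. -/
theorem le_of_mem_subcritical {n : ℕ} {b μ : ℝ} (h : μ ∈ subcritical n b) :
    μ ≤ 2 * n + n * |b - 2 * n| + b ^ 2 := by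
  by_contra! hlt
  have hW := integral_wronskian n b μ (2 * n) (2 * n)
  have hflux : radialFlux n (2 * n) (2 * n) 1 = 0 := by
    simp [radialFlux, kummer_ground, kummerDeriv_ground]
  have hpos1 : 0 < radial n (2 * n) (2 * n) 1 := radial_pos one_pos (by simp [kummer_ground])
  rw [hflux, zero_mul, sub_zero] at hW
  have hle : ∫ r in (0 : ℝ)..1, ((b - 2 * n) * (-n + (b + 2 * n) / 4 * r ^ 2) - (μ - 2 * n)) *
        (radial n b μ r * radial n (2 * n) (2 * n) r * r) ≤ ∫ r in (0 : ℝ)..1, (0 : ℝ) := by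
    have hu := continuous_radial_right n b μ
    have hu' := continuous_radial_right n (2 * n) (2 * n)
    refine intervalIntegral.integral_mono_on_of_le_Ioo zero_le_one
      (Continuous.intervalIntegrable (by fun_prop) 0 1) (by simp) fun r hr => ?_
    have h1 : 0 < radial n b μ r :=
      radial_pos hr.1 (h.1 _ ⟨by positivity, pow_le_one₀ hr.1.le hr.2.le⟩)
    have h2 : 0 < radial n (2 * n) (2 * n) r := radial_pos hr.1 (by simp [kummer_ground])
    have hr2 : r ^ 2 ≤ 1 := pow_le_one₀ hr.1.le hr.2.le
    refine mul_nonpos_of_nonpos_of_nonneg ?_ (by have := hr.1; positivity)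
    have h3 := neg_abs_le (b - 2 * n)
    nlinarith [sq_nonneg r, sq_nonneg b, mul_nonneg (sq_nonneg b) (sub_nonneg.2 hr2),
      mul_nonneg (sq_nonneg (n : ℝ)) (sq_nonneg r), n.cast_nonneg (α := ℝ)]
  have := mul_pos h.2 hpos1
  simp at hle
  linarith

/-- For such `μ` all Kummer coefficients are nonnegative, and `b (1 + 2 k) - μ ≥ b (n + 1 + k)`. The
recurrence then gives `2 c (k + 1) ≥ (b / 2) c k`, so the derivative term in the flux outweighs the
term `-(b / 2) w`. -/
theorem mem_subcritical_of_neg {n : ℕ} {b μ : ℝ} (hb : 0 < b) (hμ : μ < -(b * n)) :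
    μ ∈ subcritical n b := by
  have hμ0 : μ < 0 := hμ.trans_le (by simp; positivity)
  have hc : ∀ k, 0 ≤ kummerCoeff n b μ k := fun k =>
    Finset.prod_nonneg fun j _ => div_nonneg (by nlinarith [mul_nonneg hb.le j.cast_nonneg])
      (by positivity)
  have hpos : ∀ t ∈ Icc (0 : ℝ) 1, 0 < kummer n b μ t := by
    intro t ht
    refine (summable_egf (abs_kummerCoeff_le n b μ) t).tsum_pos
      (fun k => mul_nonneg (hc k) (by have := ht.1; positivity)) 0 ?_
    simp [kummerCoeff_zero]
  refine ⟨hpos, ?_⟩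
  have h1 : b / 2 * kummer n b μ 1 < 2 * kummerDeriv n b μ 1 := by
    have key : ∀ k : ℕ, b / 2 * kummerCoeff n b μ k ≤ 2 * kummerCoeff n b μ (k + 1) := by
      intro k
      have hn : (0 : ℝ) < n + 1 + k := by positivity
      have hs := kummerCoeff_succ n b μ k
      have := mul_nonneg hb.le (k.cast_nonneg (α := ℝ))
      have h2 : b * (n + 1 + k) * kummerCoeff n b μ k ≤ (b * (1 + 2 * k) - μ) * kummerCoeff n b μ k :=
        mul_le_mul_of_nonneg_right (by linarith) (hc k)
      refine le_of_mul_le_mul_left ?_ hn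
      linarith
    have key0 : b / 2 * kummerCoeff n b μ 0 < 2 * kummerCoeff n b μ (0 + 1) := by
      have hn : (0 : ℝ) < n + 1 := by positivity
      have hs := kummerCoeff_succ n b μ 0
      rw [kummerCoeff_zero] at hs ⊢
      simp only [Nat.cast_zero, add_zero, mul_zero, mul_one] at hs ⊢
      refine lt_of_mul_lt_mul_left ?_ hn.le
      linarith
    have hs0 := summable_egf (abs_kummerCoeff_le n b μ) 1
    have hs1 := summable_egf (abs_shift_le (abs_kummerCoeff_le n b μ)) 1
    rw [kummer, kummerDeriv, egf, egf, ← tsum_mul_left, ← tsum_mul_left]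
    refine (hs0.mul_left _).tsum_lt_tsum (i := 0) (fun k => ?_) ?_ (hs1.mul_left _)
    · rw [← mul_assoc, ← mul_assoc]
      exact mul_le_mul_of_nonneg_right (key k) (by positivity)
    · simpa using key0
  have hg := gauge_pos n b one_pos
  refine mul_pos hg ?_
  have := mul_nonneg (n.cast_nonneg (α := ℝ)) (hpos 1 (by simp)).le
  norm_num
  linarith

/-- There is a value of `μ` whose regular solution is a positive eigenfunction. -/
theorem exists_kummer_pos (n : ℕ) {b : ℝ} (hb : 0 < b) :
    ∃ μ, (∀ t ∈ Icc (0 : ℝ) 1, 0 < kummer n b μ t) ∧ radialFlux n b μ 1 = 0 := by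
  have hne : (subcritical n b).Nonempty := ⟨-(b * n) - 1, mem_subcritical_of_neg hb (by linarith)⟩
  have hbdd : BddAbove (subcritical n b) := ⟨_, fun μ hμ => le_of_mem_subcritical hμ⟩
  set μ := sSup (subcritical n b) with hμ
  have hcl : μ ∈ closure (subcritical n b) := csSup_mem_closure hne hbdd
  have hnot : μ ∉ subcritical n b := by
    intro hmem
    obtain ⟨ε, hε, hball⟩ := Metric.isOpen_iff.1 (isOpen_subcritical n b) μ hmem
    have : μ + ε / 2 ∈ subcritical n b :=
      hball (by rw [Metric.mem_ball, Real.dist_eq, add_sub_cancel_left, abs_of_pos] <;> linarith)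
    linarith [le_csSup hbdd this]
  have hnonneg : ∀ t ∈ Icc (0 : ℝ) 1, 0 ≤ kummer n b μ t := by
    intro t ht
    have hcont : Continuous fun μ => kummer n b μ t :=
      (continuous_kummer n).comp (by fun_prop : Continuous fun μ : ℝ => ((b, μ), t))
    exact closure_minimal (fun ν hν => (hν.1 t ht).le) (isClosed_le continuous_const hcont) hcl
  have hflux : 0 ≤ radialFlux n b μ 1 := by
    have hcont : Continuous fun μ => radialFlux n b μ 1 :=
      (continuous_radialFlux n).comp (by fun_prop : Continuous fun μ : ℝ => ((b, μ), (1 : ℝ)))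
    exact closure_minimal (fun ν hν => hν.2.le) (isClosed_le continuous_const hcont) hcl
  have hpos : ∀ t ∈ Icc (0 : ℝ) 1, 0 < kummer n b μ t := by
    intro t ht
    refine (hnonneg t ht).lt_of_ne' fun h0 => ?_
    have ht0 : 0 < t := ht.1.lt_of_ne (by rintro rfl; simp [kummer_zero] at h0)
    -- A zero of a nonnegative function is an interior minimum, hence a double zero. At the end
    -- point `1`, nonnegativity makes the left derivative nonpositive and the flux condition makes
    -- it nonnegative.
    refine (kummer_ne_zero_or_kummerDeriv_ne_zero n b μ ht0).elim (· h0) (· ?_)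
    rcases ht.2.lt_or_eq with ht1 | rfl
    · have hmin : IsLocalMin (kummer n b μ) t := by
        filter_upwards [Ioo_mem_nhds ht0 ht1] with x hx
        rw [h0]
        exact hnonneg x ⟨hx.1.le, hx.2.le⟩
      exact hmin.hasDerivAt_eq_zero (hasDerivAt_kummer n b μ t)
    · refine le_antisymm ?_ ?_
      · have hsub : Iio (1 : ℝ) ⊆ {1}ᶜ := fun x hx => ne_of_lt hx
        have hslope := (hasDerivAt_kummer n b μ 1).tendsto_slope.mono_left
          (nhdsWithin_mono 1 hsub)
        refine le_of_tendsto hslope ?_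
        filter_upwards [Ioo_mem_nhdsLT zero_lt_one] with x hx
        rw [slope_def_field, h0]
        exact div_nonpos_of_nonneg_of_nonpos (by linarith [hnonneg x ⟨hx.1.le, hx.2.le⟩])
          (by linarith [hx.2])
      · have hg := gauge_pos n b one_pos
        simp only [radialFlux, one_pow, h0, mul_zero, zero_add, mul_one] at hflux
        have := nonneg_of_mul_nonneg_right hflux hg
        linarith
  exact ⟨μ, hpos, hflux.antisymm' (not_lt.1 fun h => hnot ⟨hpos, h⟩)⟩

/-! ### Picone's identity: minimality and simplicity -/

/-- A function continuous at `0` cannot have a derivative of size `-c / r` near `0`. -/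
theorem frequently_lt_mul_deriv {h : ℝ → ℝ} (hc : ContinuousOn h (Icc 0 1))
    (hd : DifferentiableOn ℝ h (Ioo 0 1)) {c : ℝ} (hc0 : 0 < c) :
    ∃ᶠ r in 𝓝[>] (0 : ℝ), -c < r * deriv h r := by
  intro hev
  obtain ⟨δ, hδ, hδ'⟩ := mem_nhdsGT_iff_exists_Ioo_subset.1 hev
  have hδ0 : (0 : ℝ) < δ := hδ
  have h0 : ContinuousWithinAt h (Icc 0 1) 0 := hc 0 (by simp)
  have hsmall : ∀ᶠ r in 𝓝[>] (0 : ℝ), |h r - h 0| < c / 4 := by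
    have : Tendsto h (𝓝[>] 0) (𝓝 (h 0)) :=
      h0.mono_of_mem_nhdsWithin (Icc_mem_nhdsGT zero_lt_one)
    exact this.eventually (Metric.ball_mem_nhds (h 0) (by linarith : 0 < c / 4))
  obtain ⟨η, hη, hη'⟩ := mem_nhdsGT_iff_exists_Ioo_subset.1 hsmall
  have hη0 : (0 : ℝ) < η := hη
  -- On `[r, 2 r]` the mean value point satisfies `x < 2 r`, so `x * h' x ≤ -c` forces a drop of
  -- more than `c / 2`, while both end values lie within `c / 4` of `h 0`.
  set r := min δ (min η 1) / 4 with hr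
  have hm : 0 < min δ (min η 1) := by positivity
  have hm1 := min_le_left δ (min η 1)
  have hm2 := (min_le_right δ (min η 1)).trans (min_le_left η 1)
  have hm3 := (min_le_right δ (min η 1)).trans (min_le_right η 1)
  have hr0 : 0 < r := by positivity
  obtain ⟨x, hx, hxe⟩ := exists_deriv_eq_slope h (by linarith : r < 2 * r)
    (hc.mono (Icc_subset_Icc hr0.le (by linarith)))
    (hd.mono (Ioo_subset_Ioo hr0.le (by linarith)))
  have hxle : ¬ -c < x * deriv h x := hδ' ⟨hr0.trans hx.1, by linarith [hx.2]⟩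
  have h1 : |h r - h 0| < c / 4 := hη' ⟨hr0, by linarith⟩
  have h2 : |h (2 * r) - h 0| < c / 4 := hη' ⟨by linarith, by linarith⟩
  rw [abs_lt] at h1 h2
  rw [hxe] at hxle
  apply hxle
  rw [show 2 * r - r = r by ring, ← mul_div_assoc, lt_div_iff₀ hr0]
  nlinarith [hx.1, hx.2]

/-- The derivative is not bounded below by `c > 0` near a point with vanishing left derivative. -/
theorem frequently_deriv_lt {h : ℝ → ℝ} (hc : ContinuousOn h (Icc 0 1))
    (hd : DifferentiableOn ℝ h (Ioo 0 1)) (h1 : HasDerivWithinAt h 0 (Icc 0 1) 1) {c : ℝ}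
    (hc0 : 0 < c) : ∃ᶠ r in 𝓝[<] (1 : ℝ), deriv h r < c := by
  intro hev
  have h1' : HasDerivWithinAt h 0 (Iio 1) 1 :=
    h1.mono_of_mem_nhdsWithin (Icc_mem_nhdsLT zero_lt_one)
  have hslope := (hasDerivWithinAt_iff_tendsto_slope' (by simp)).1 h1'
  obtain ⟨δ, hδ, hδ'⟩ := mem_nhdsLT_iff_exists_Ioo_subset.1 hev
  have hmem : ∀ᶠ r in 𝓝[<] (1 : ℝ), r ∈ Ioo (max δ 0) 1 :=
    Ioo_mem_nhdsLT (max_lt hδ zero_lt_one)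
  obtain ⟨r, hr, hrs⟩ := (hmem.and (hslope.eventually_lt_const hc0)).exists
  have hr0 : 0 < r := (le_max_right _ _).trans_lt hr.1
  obtain ⟨x, hx, hxe⟩ := exists_deriv_eq_slope h hr.2
    (hc.mono (Icc_subset_Icc hr0.le le_rfl)) (hd.mono (Ioo_subset_Ioo hr0.le le_rfl))
  refine hδ' (a := x) ⟨(le_max_left _ _).trans_lt (hr.1.trans hx.1), hx.2⟩ ?_
  rw [slope_comm, slope_def_field] at hrs
  rwa [hxe]

/-- The logarithmic derivative `r u'(r) / u(r)` of the regular solution. -/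
noncomputable def logDerivRadial (n : ℕ) (b μ r : ℝ) : ℝ :=
  (n - b / 2 * r ^ 2) + 2 * r ^ 2 * kummerDeriv n b μ (r ^ 2) / kummer n b μ (r ^ 2)

theorem radialFlux_eq {n : ℕ} {b μ r : ℝ} (h : kummer n b μ (r ^ 2) ≠ 0) :
    radialFlux n b μ r = radial n b μ r * logDerivRadial n b μ r := by
  unfold radialFlux radial logDerivRadial
  field_simp

theorem continuousAt_logDerivRadial {n : ℕ} {b μ r : ℝ} (h : kummer n b μ (r ^ 2) ≠ 0) :
    ContinuousAt (logDerivRadial n b μ) r := by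
  have h0 : ContinuousAt (fun x => kummer n b μ (x ^ 2)) r :=
    (hasDerivAt_comp_sq (hasDerivAt_kummer n b μ (r ^ 2))).continuousAt
  have h1 : ContinuousAt (fun x => kummerDeriv n b μ (x ^ 2)) r :=
    (hasDerivAt_comp_sq (hasDerivAt_kummerDeriv n b μ (r ^ 2))).continuousAt
  unfold logDerivRadial
  fun_prop (disch := assumption)

/-- The Riccati equation of the linear one. Working with this quotient avoids dividing by `u` at the
origin, where `u` vanishes if `n > 0`. -/
theorem hasDerivAt_logDerivRadial {n : ℕ} {b μ r : ℝ} (hr : 0 < r)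
    (h : ∀ t ∈ Icc (0 : ℝ) 1, 0 < kummer n b μ t) (hr1 : r < 1) :
    HasDerivAt (logDerivRadial n b μ)
      (r * (potential n b r - μ) - logDerivRadial n b μ r ^ 2 / r) r := by
  have hmem : ∀ x ∈ Ioo (0 : ℝ) 1, 0 < kummer n b μ (x ^ 2) := fun x hx =>
    h _ ⟨by positivity, pow_le_one₀ hx.1.le hx.2.le⟩
  have hu := (radial_pos hr (hmem r ⟨hr, hr1⟩)).ne'
  have hev : logDerivRadial n b μ =ᶠ[𝓝 r] fun x => radialFlux n b μ x / radial n b μ x := by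
    filter_upwards [Ioo_mem_nhds hr hr1] with x hx
    rw [radialFlux_eq (hmem x hx).ne', mul_div_cancel_left₀ _ (radial_pos hx.1 (hmem x hx)).ne']
  refine HasDerivAt.congr_of_eventuallyEq ?_ hev
  refine ((hasDerivAt_radialFlux n b μ hr.ne').div (hasDerivAt_radial n b μ hr.ne')
    hu).congr_deriv ?_
  rw [radialFlux_eq (hmem r ⟨hr, hr1⟩).ne']
  field_simp

section Picone

variable {n : ℕ} {b μ lam : ℝ} {g : ℝ → ℝ}

theorem IsEigenfunction.hasDerivAt (hg : IsEigenfunction n b μ g) {r : ℝ} (hr : r ∈ Ioo (0 : ℝ) 1) :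
    HasDerivAt g (deriv g r) r :=
  ((hg.contDiffOn.differentiableOn two_ne_zero).differentiableAt
    (isOpen_Ioo.mem_nhds hr)).hasDerivAt

theorem IsEigenfunction.hasDerivAt_mul_deriv (hg : IsEigenfunction n b μ g) {r : ℝ}
    (hr : r ∈ Ioo (0 : ℝ) 1) :
    HasDerivAt (fun x => x * deriv g x) (r * (potential n b r - μ) * g r) r := by
  have h1 : ContDiffOn ℝ 1 (deriv g) (Ioo 0 1) :=
    hg.contDiffOn.deriv_of_isOpen isOpen_Ioo (by norm_num)
  have h2 : HasDerivAt (deriv g) (deriv (deriv g) r) r :=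
    ((h1.differentiableOn one_ne_zero).differentiableAt (isOpen_Ioo.mem_nhds hr)).hasDerivAt
  refine ((hasDerivAt_id r).mul h2).congr_deriv ?_
  have heq := hg.equation r hr
  have hr0 : r ≠ 0 := hr.1.ne'
  have hinv : r * (1 / r) = 1 := by field_simp
  simp only [id, potential, one_mul]
  linear_combination -r * heq - deriv g r * hinv

/-- Picone's function `r g g' - g² r u'/u`. -/
noncomputable def picone (n : ℕ) (b lam : ℝ) (g : ℝ → ℝ) (r : ℝ) : ℝ :=
  g r * (r * deriv g r) - g r ^ 2 * logDerivRadial n b lam r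

theorem IsEigenfunction.hasDerivAt_picone (hg : IsEigenfunction n b μ g)
    (hpos : ∀ t ∈ Icc (0 : ℝ) 1, 0 < kummer n b lam t) {r : ℝ} (hr : r ∈ Ioo (0 : ℝ) 1) :
    HasDerivAt (picone n b lam g)
      ((lam - μ) * r * g r ^ 2 + (r * deriv g r - g r * logDerivRadial n b lam r) ^ 2 / r) r := by
  refine (((hg.hasDerivAt hr).mul (hg.hasDerivAt_mul_deriv hr)).sub
    (((hg.hasDerivAt hr).pow 2).mul (hasDerivAt_logDerivRadial hr.1 hpos hr.2))).congr_deriv ?_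
  have hr0 : r ≠ 0 := hr.1.ne'
  simp only [Pi.pow_apply, Nat.cast_ofNat, Nat.add_one_sub_one, pow_one]
  field_simp
  ring

theorem IsEigenfunction.monotoneOn_picone (hg : IsEigenfunction n b μ g)
    (hpos : ∀ t ∈ Icc (0 : ℝ) 1, 0 < kummer n b lam t) (hle : μ ≤ lam) :
    MonotoneOn (picone n b lam g) (Ioo 0 1) := by
  refine monotoneOn_of_deriv_nonneg (convex_Ioo 0 1)
    (fun x hx => (hg.hasDerivAt_picone hpos hx).continuousAt.continuousWithinAt)
    (fun x hx => (hg.hasDerivAt_picone hpos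
      (interior_subset hx)).differentiableAt.differentiableWithinAt) fun x hx => ?_
  replace hx := interior_subset hx
  rw [(hg.hasDerivAt_picone hpos hx).deriv]
  have := hx.1
  have := sub_nonneg.2 hle
  positivity

theorem IsEigenfunction.mul_deriv_sq (hg : IsEigenfunction n b μ g) {r : ℝ}
    (hr : r ∈ Ioo (0 : ℝ) 1) :
    r * deriv (fun x => g x ^ 2) r =
      2 * (picone n b lam g r + g r ^ 2 * logDerivRadial n b lam r) := by
  have : HasDerivAt (fun x => g x ^ 2) (2 * g r * deriv g r) r :=
    ((hg.hasDerivAt hr).pow 2).congr_deriv (by simp)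
  rw [this.deriv, picone]
  ring

theorem IsEigenfunction.continuousOn_sq (hg : IsEigenfunction n b μ g) :
    ContinuousOn (fun x => g x ^ 2) (Icc 0 1) :=
  hg.continuousOn.pow 2

theorem IsEigenfunction.differentiableOn_sq (hg : IsEigenfunction n b μ g) :
    DifferentiableOn ℝ (fun x => g x ^ 2) (Ioo 0 1) :=
  (hg.contDiffOn.differentiableOn two_ne_zero).pow 2

/-- No limit of `r g'` at `0` is assumed. A negative value would, by monotonicity, persist down to
`0` and force `r (g²)' ≤ -c` there, against continuity of `g` at `0`. The remainder `g² r u'/u`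
tends to `0`: either `n = 0`, or `g 0 = 0`. -/
theorem IsEigenfunction.picone_nonneg (hg : IsEigenfunction n b μ g)
    (hpos : ∀ t ∈ Icc (0 : ℝ) 1, 0 < kummer n b lam t) (hle : μ ≤ lam) {r : ℝ}
    (hr : r ∈ Ioo (0 : ℝ) 1) : 0 ≤ picone n b lam g r := by
  by_contra! hneg
  have hlim : Tendsto (fun x => g x ^ 2 * logDerivRadial n b lam x) (𝓝[>] 0) (𝓝 0) := by
    have h1 : Tendsto g (𝓝[>] 0) (𝓝 (g 0)) :=
      (hg.continuousOn 0 (by simp)).mono_of_mem_nhdsWithin (Icc_mem_nhdsGT zero_lt_one)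
    have h2 : Tendsto (logDerivRadial n b lam) (𝓝[>] 0) (𝓝 (logDerivRadial n b lam 0)) :=
      (continuousAt_logDerivRadial (by simp [kummer_zero])).tendsto.mono_left nhdsWithin_le_nhds
    have h3 := (h1.pow 2).mul h2
    have h4 : g 0 ^ 2 * logDerivRadial n b lam 0 = 0 := by
      rcases Nat.eq_zero_or_pos n with rfl | hn
      · simp [logDerivRadial]
      · simp [hg.dirichlet_zero hn]
    rwa [h4] at h3
  refine frequently_lt_mul_deriv hg.continuousOn_sq hg.differentiableOn_sq (neg_pos.2 hneg) ?_
  filter_upwards [Ioo_mem_nhdsGT hr.1,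
    hlim.eventually_lt_const (by linarith : 0 < -picone n b lam g r / 2)] with x hx hxs
  have hx1 : x ∈ Ioo (0 : ℝ) 1 := ⟨hx.1, hx.2.trans hr.2⟩
  have := hg.monotoneOn_picone hpos hle hx1 hr hx.2.le
  rw [hg.mul_deriv_sq (lam := lam) hx1]
  linarith

/-- The mirror argument at `1`: a positive value would persist and keep `(g²)'` bounded below by a
positive constant, against the Neumann condition of `g`. The remainder vanishes there by the Neumann
condition of `u`. -/
theorem IsEigenfunction.picone_nonpos (hg : IsEigenfunction n b μ g)
    (hpos : ∀ t ∈ Icc (0 : ℝ) 1, 0 < kummer n b lam t) (hflux : radialFlux n b lam 1 = 0)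
    (hle : μ ≤ lam) {r : ℝ} (hr : r ∈ Ioo (0 : ℝ) 1) : picone n b lam g r ≤ 0 := by
  by_contra! hneg
  have hk : 0 < kummer n b lam (1 ^ 2) := by simpa using hpos 1 (by simp)
  have hlim : Tendsto (fun x => g x ^ 2 * logDerivRadial n b lam x) (𝓝[<] 1) (𝓝 0) := by
    have h1 : Tendsto g (𝓝[<] 1) (𝓝 (g 1)) :=
      (hg.continuousOn 1 (by simp)).mono_of_mem_nhdsWithin (Icc_mem_nhdsLT zero_lt_one)
    have h2 : Tendsto (logDerivRadial n b lam) (𝓝[<] 1) (𝓝 (logDerivRadial n b lam 1)) :=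
      (continuousAt_logDerivRadial hk.ne').tendsto.mono_left nhdsWithin_le_nhds
    have h3 := (h1.pow 2).mul h2
    have h4 : logDerivRadial n b lam 1 = 0 :=
      (mul_eq_zero.1 ((radialFlux_eq hk.ne').symm.trans hflux)).resolve_left
        (radial_pos one_pos hk).ne'
    rwa [h4, mul_zero] at h3
  have hd1 : HasDerivWithinAt (fun x => g x ^ 2) 0 (Icc 0 1) 1 :=
    (hg.neumann_one.pow 2).congr_deriv (by simp)
  refine frequently_deriv_lt hg.continuousOn_sq hg.differentiableOn_sq hd1 hneg ?_
  filter_upwards [Ioo_mem_nhdsLT hr.2,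
    hlim.eventually_const_lt (by linarith : -(picone n b lam g r / 2) < 0)] with x hx hxs
  have hx1 : x ∈ Ioo (0 : ℝ) 1 := ⟨hr.1.trans hx.1, hx.2⟩
  have h1 := hg.monotoneOn_picone hpos hle hr hx1 hx.1.le
  have h2 := hg.mul_deriv_sq (lam := lam) hx1
  nlinarith [hx1.1, hx1.2]

/-- Picone's identity forces equality when the eigenvalue does not exceed that of a positive
eigenfunction. -/
theorem IsEigenfunction.picone_rigidity (hg : IsEigenfunction n b μ g)
    (hpos : ∀ t ∈ Icc (0 : ℝ) 1, 0 < kummer n b lam t) (hflux : radialFlux n b lam 1 = 0)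
    (hle : μ ≤ lam) {r : ℝ} (hr : r ∈ Ioo (0 : ℝ) 1) :
    (lam - μ) * g r ^ 2 = 0 ∧ r * deriv g r = g r * logDerivRadial n b lam r := by
  have hev : picone n b lam g =ᶠ[𝓝 r] fun _ => 0 := by
    filter_upwards [isOpen_Ioo.mem_nhds hr] with x hx using
      le_antisymm (hg.picone_nonpos hpos hflux hle hx) (hg.picone_nonneg hpos hle hx)
  have h0 := (hg.hasDerivAt_picone hpos hr).unique
    ((hasDerivAt_const r (0 : ℝ)).congr_of_eventuallyEq hev)
  have hr0 := hr.1
  have h1 := sub_nonneg.2 hle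
  have h2 : 0 ≤ (lam - μ) * r * g r ^ 2 := by positivity
  have h3 : 0 ≤ (r * deriv g r - g r * logDerivRadial n b lam r) ^ 2 / r := by positivity
  refine ⟨?_, ?_⟩
  · have : r * ((lam - μ) * g r ^ 2) = 0 := by linarith
    exact (mul_eq_zero.1 this).resolve_left hr0.ne'
  · have : (r * deriv g r - g r * logDerivRadial n b lam r) ^ 2 / r = 0 := by linarith
    rw [div_eq_zero_iff, or_iff_left hr0.ne', sq_eq_zero_iff, sub_eq_zero] at this
    exact this

theorem Ioo_zero_one_dense : Icc (0 : ℝ) 1 ⊆ closure (Ioo 0 1) := by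
  rw [closure_Ioo zero_ne_one]

theorem isLeast_eigenvalues (hpos : ∀ t ∈ Icc (0 : ℝ) 1, 0 < kummer n b lam t)
    (hflux : radialFlux n b lam 1 = 0) : IsLeast (eigenvalues n b) lam := by
  refine ⟨⟨_, isEigenfunction_radial hflux hpos⟩, ?_⟩
  rintro μ ⟨g, hg⟩
  by_contra! hlt
  have hzero : EqOn g (fun _ => 0) (Ioo 0 1) := fun r hr => by
    have := (hg.picone_rigidity hpos hflux hlt.le hr).1
    simpa [(sub_pos.2 hlt).ne'] using this
  obtain ⟨r, hr, hne⟩ := hg.nontrivial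
  exact hne (hzero.of_subset_closure hg.continuousOn continuousOn_const Ioo_subset_Icc_self
    Ioo_zero_one_dense hr)

/-- The lowest eigenvalue is simple. -/
theorem IsEigenfunction.eq_const_mul_radial (hg : IsEigenfunction n b lam g)
    (hpos : ∀ t ∈ Icc (0 : ℝ) 1, 0 < kummer n b lam t) (hflux : radialFlux n b lam 1 = 0) :
    ∃ c, ∀ r ∈ Icc (0 : ℝ) 1, g r = c * radial n b lam r := by
  have hk : ∀ r ∈ Ioo (0 : ℝ) 1, 0 < kummer n b lam (r ^ 2) := fun r hr =>
    hpos _ ⟨by positivity, pow_le_one₀ hr.1.le hr.2.le⟩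
  have hder : ∀ r ∈ Ioo (0 : ℝ) 1, HasDerivAt (fun x => g x / radial n b lam x) 0 r := by
    intro r hr
    have hr0 : r ≠ 0 := hr.1.ne'
    have hu := (radial_pos hr.1 (hk r hr)).ne'
    refine ((hg.hasDerivAt hr).div (hasDerivAt_radial n b lam hr0) hu).congr_deriv ?_
    rw [radialFlux_eq (hk r hr).ne']
    have := (hg.picone_rigidity hpos hflux le_rfl hr).2
    field_simp
    linear_combination this
  have hmid : (1 / 2 : ℝ) ∈ Ioo (0 : ℝ) 1 := by norm_num
  refine ⟨g (1 / 2) / radial n b lam (1 / 2), fun r hr => ?_⟩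
  have heq : EqOn g (fun r => g (1 / 2) / radial n b lam (1 / 2) * radial n b lam r)
      (Ioo 0 1) := by
    intro r hr
    have hconst := isOpen_Ioo.is_const_of_deriv_eq_zero isPreconnected_Ioo
      (fun x hx => (hder x hx).differentiableAt.differentiableWithinAt)
      (fun x hx => (hder x hx).deriv) hr hmid
    dsimp only at hconst ⊢
    rw [← hconst, div_mul_cancel₀ _ (radial_pos hr.1 (hk r hr)).ne']
  exact heq.of_subset_closure hg.continuousOn
    (continuous_const.mul (continuous_radial_right n b lam)).continuousOn Ioo_subset_Icc_self
    Ioo_zero_one_dense hr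

end Picone

/-! ### Ground states and the Feynman–Hellmann formula -/

theorem kummer_lowestEigenvalue_pos (n : ℕ) {b : ℝ} (hb : 0 < b) :
    ∀ t ∈ Icc (0 : ℝ) 1, 0 < kummer n b (lowestEigenvalue n b) t := by
  obtain ⟨lam, hpos, hflux⟩ := exists_kummer_pos n hb
  rwa [lowestEigenvalue, (isLeast_eigenvalues hpos hflux).csInf_eq]

theorem radialFlux_lowestEigenvalue (n : ℕ) {b : ℝ} (hb : 0 < b) :
    radialFlux n b (lowestEigenvalue n b) 1 = 0 := by
  obtain ⟨lam, hpos, hflux⟩ := exists_kummer_pos n hb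
  rwa [lowestEigenvalue, (isLeast_eigenvalues hpos hflux).csInf_eq]

/-- The positive eigenfunction, before normalization. -/
noncomputable def ground (n : ℕ) (b r : ℝ) : ℝ :=
  radial n b (lowestEigenvalue n b) r

theorem ground_pos (n : ℕ) {b r : ℝ} (hb : 0 < b) (hr0 : 0 < r) (hr1 : r ≤ 1) :
    0 < ground n b r :=
  radial_pos hr0 (kummer_lowestEigenvalue_pos n hb _ ⟨by positivity, pow_le_one₀ hr0.le hr1⟩)

theorem continuous_ground (n : ℕ) (b : ℝ) : Continuous (ground n b) :=
  continuous_radial_right n b _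

theorem integral_ground_mul_pos (n : ℕ) {b b' : ℝ} (hb : 0 < b) (hb' : 0 < b') :
    0 < ∫ r in (0 : ℝ)..1, ground n b r * ground n b' r * r := by
  have h1 := continuous_ground n b
  have h2 := continuous_ground n b'
  refine intervalIntegral.intervalIntegral_pos_of_pos_on
    (Continuous.intervalIntegrable (by fun_prop) 0 1) (fun r hr => ?_) zero_lt_one
  have := ground_pos n hb hr.1 hr.2.le
  have := ground_pos n hb' hr.1 hr.2.le
  have := hr.1
  positivity

/-- Both fluxes vanish at `1`, so the Wronskian has no boundary term. The identity is exact and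
presupposes no regularity of the eigenvalue in `b`. -/
theorem lowestEigenvalue_sub (n : ℕ) {b b' : ℝ} (hb : 0 < b) (hb' : 0 < b') :
    (lowestEigenvalue n b - lowestEigenvalue n b') *
        ∫ r in (0 : ℝ)..1, ground n b r * ground n b' r * r =
      (b - b') * ∫ r in (0 : ℝ)..1, (-n + (b + b') / 4 * r ^ 2) *
        (ground n b r * ground n b' r * r) := by
  have h1 := continuous_ground n b
  have h2 := continuous_ground n b'
  have hW := integral_wronskian n b (lowestEigenvalue n b) b' (lowestEigenvalue n b')
  rw [radialFlux_lowestEigenvalue n hb, radialFlux_lowestEigenvalue n hb', zero_mul, zero_mul,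
    sub_zero] at hW
  rw [eq_comm, ← sub_eq_zero, ← intervalIntegral.integral_const_mul,
    ← intervalIntegral.integral_const_mul, ← intervalIntegral.integral_sub
      (Continuous.intervalIntegrable (by fun_prop) 0 1)
      (Continuous.intervalIntegrable (by fun_prop) 0 1), ← hW]
  congr 1
  funext r
  simp only [ground]
  ring

/-- Both ground states are positive, so their product is a positive weight against which `-n + (b +
b') / 4 * r ^ 2` can be bounded pointwise. -/
theorem abs_lowestEigenvalue_sub_le (n : ℕ) {b b' : ℝ} (hb : 0 < b) (hb' : 0 < b') :
    |lowestEigenvalue n b - lowestEigenvalue n b'| ≤ (n + (b + b') / 4) * |b - b'| := by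
  have h1 := continuous_ground n b
  have h2 := continuous_ground n b'
  have hI := integral_ground_mul_pos n hb hb'
  have hJ : |∫ r in (0 : ℝ)..1, (-n + (b + b') / 4 * r ^ 2) *
      (ground n b r * ground n b' r * r)| ≤
      (n + (b + b') / 4) * ∫ r in (0 : ℝ)..1, ground n b r * ground n b' r * r := by
    rw [← intervalIntegral.integral_const_mul]
    refine (intervalIntegral.abs_integral_le_integral_abs zero_le_one).trans ?_
    refine intervalIntegral.integral_mono_on_of_le_Ioo zero_le_one
      (Continuous.intervalIntegrable (by fun_prop) 0 1)
      (Continuous.intervalIntegrable (by fun_prop) 0 1) fun r hr => ?_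
    have hu := ground_pos n hb hr.1 hr.2.le
    have hu' := ground_pos n hb' hr.1 hr.2.le
    have hr0 := hr.1
    have hr2 : r ^ 2 ≤ 1 := pow_le_one₀ hr.1.le hr.2.le
    rw [abs_mul, abs_of_pos (by positivity : 0 < ground n b r * ground n b' r * r)]
    refine mul_le_mul_of_nonneg_right ?_ (by positivity)
    have hn := n.cast_nonneg (α := ℝ)
    rw [abs_le]
    constructor <;> nlinarith [sq_nonneg r]
  refine le_of_mul_le_mul_right ?_ hI
  calc _ = |(lowestEigenvalue n b - lowestEigenvalue n b') *
        ∫ r in (0 : ℝ)..1, ground n b r * ground n b' r * r| := by rw [abs_mul, abs_of_pos hI]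
    _ = |b - b'| * |∫ r in (0 : ℝ)..1, (-n + (b + b') / 4 * r ^ 2) *
        (ground n b r * ground n b' r * r)| := by rw [lowestEigenvalue_sub n hb hb', abs_mul]
    _ ≤ |b - b'| * _ := mul_le_mul_of_nonneg_left hJ (abs_nonneg _)
    _ = _ := by ring

theorem continuousAt_lowestEigenvalue (n : ℕ) {β : ℝ} (hβ : 0 < β) :
    ContinuousAt (lowestEigenvalue n) β := by
  refine tendsto_iff_norm_sub_tendsto_zero.2 ?_
  have hlim : Tendsto (fun b => ((n : ℝ) + (b + β) / 4) * |b - β|) (𝓝 β) (𝓝 0) := by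
    have : Continuous fun b => ((n : ℝ) + (b + β) / 4) * |b - β| := by fun_prop
    simpa using this.tendsto β
  refine squeeze_zero' (Eventually.of_forall fun _ => norm_nonneg _) ?_ hlim
  filter_upwards [lt_mem_nhds hβ] with b hb using abs_lowestEigenvalue_sub_le n hb hβ

/-- The Feynman–Hellmann formula. -/
theorem hasDerivAt_lowestEigenvalue (n : ℕ) {β : ℝ} (hβ : 0 < β) :
    HasDerivAt (lowestEigenvalue n)
      ((∫ r in (0 : ℝ)..1, (-n + (β + β) / 4 * r ^ 2) * (ground n β r * ground n β r * r)) /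
        ∫ r in (0 : ℝ)..1, ground n β r * ground n β r * r) β := by
  have hg := continuous_ground n β
  have hpair : ContinuousAt (fun b => (b, lowestEigenvalue n b)) β :=
    continuousAt_id.prodMk (continuousAt_lowestEigenvalue n hβ)
  have hrad := continuous_radial n
  have hI : ContinuousAt (fun b => ∫ r in (0 : ℝ)..1, ground n b r * ground n β r * r) β := by
    have h : Continuous fun p : ℝ × ℝ =>
        ∫ r in (0 : ℝ)..1, radial n p.1 p.2 r * ground n β r * r :=
      intervalIntegral.continuous_parametric_intervalIntegral_of_continuous'
        ((hrad.mul (hg.comp continuous_snd)).mul continuous_snd) 0 1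
    exact ContinuousAt.comp (f := fun b => (b, lowestEigenvalue n b)) h.continuousAt hpair
  have hJ : ContinuousAt (fun b => ∫ r in (0 : ℝ)..1, (-n + (b + β) / 4 * r ^ 2) *
      (ground n b r * ground n β r * r)) β := by
    have h : Continuous fun p : ℝ × ℝ => ∫ r in (0 : ℝ)..1, (-n + (p.1 + β) / 4 * r ^ 2) *
        (radial n p.1 p.2 r * ground n β r * r) :=
      intervalIntegral.continuous_parametric_intervalIntegral_of_continuous'
        ((by fun_prop : Continuous fun q : (ℝ × ℝ) × ℝ =>
          (-(n : ℝ) + (q.1.1 + β) / 4 * q.2 ^ 2)).mul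
          ((hrad.mul (hg.comp continuous_snd)).mul continuous_snd)) 0 1
    exact ContinuousAt.comp (f := fun b => (b, lowestEigenvalue n b)) h.continuousAt hpair
  -- For `b ≠ β` the slope equals the quotient of the two integrals exactly; continuity of the
  -- eigenvalue makes that quotient continuous at `β`.
  rw [hasDerivAt_iff_tendsto_slope]
  refine ((hJ.div hI (integral_ground_mul_pos n hβ hβ).ne').tendsto.mono_left
    nhdsWithin_le_nhds).congr' ?_
  filter_upwards [nhdsWithin_le_nhds (lt_mem_nhds hβ), self_mem_nhdsWithin] with b hb hne
  have h0 : b - β ≠ 0 := sub_ne_zero.2 hne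
  have hpos := (integral_ground_mul_pos n hb hβ).ne'
  rw [Pi.div_apply, slope_def_field, div_eq_div_iff hpos h0, lowestEigenvalue_sub n hb hβ]
  ring

/-! ### The virial identity and the boundary formula -/

/-- The virial identity, from the multiplier `r² u'`. -/
theorem virial_radial (n : ℕ) {b μ : ℝ} (hflux : radialFlux n b μ 1 = 0) :
    b ^ 2 * ∫ r in (0 : ℝ)..1, r ^ 2 * (radial n b μ r * radial n b μ r * r) =
      (((n : ℝ) - b / 2) ^ 2 - μ) * radial n b μ 1 ^ 2
        + 2 * (n * b + μ) * ∫ r in (0 : ℝ)..1, radial n b μ r * radial n b μ r * r := by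
  have hu := continuous_radial_right n b μ
  have hP := continuous_radialFlux_right n b μ
  -- `R = r² (V - μ)`, so `r (r u')' = R u` and the derivative of `R u² - (r u')²` is just `R' u²`.
  -- At `1` the flux vanishes and `R 1 = (n - b / 2)² - μ`; at `0`, `R u²` vanishes since `n = 0` or
  -- `u 0 = 0`.
  let R : ℝ → ℝ := fun r => (n : ℝ) ^ 2 - (n * b + μ) * r ^ 2 + b ^ 2 / 4 * r ^ 4
  have hR : ∀ r, HasDerivAt R (-((n * b + μ) * (2 * r)) + b ^ 2 * r ^ 3) r := by
    intro r
    refine ((((hasDerivAt_pow 2 r).const_mul (n * b + μ)).const_sub ((n : ℝ) ^ 2)).add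
      ((hasDerivAt_pow 4 r).const_mul (b ^ 2 / 4))).congr_deriv ?_
    norm_num
    ring
  have hRc : Continuous R := by fun_prop
  have hder : ∀ r ∈ Ioo (0 : ℝ) 1,
      HasDerivAt (fun r => R r * radial n b μ r ^ 2 - radialFlux n b μ r ^ 2)
        (b ^ 2 * (r ^ 2 * (radial n b μ r * radial n b μ r * r))
          - 2 * (n * b + μ) * (radial n b μ r * radial n b μ r * r)) r := by
    intro r hr
    have hr0 : r ≠ 0 := hr.1.ne'
    refine (((hR r).mul ((hasDerivAt_radial n b μ hr0).pow 2)).sub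
      ((hasDerivAt_radialFlux n b μ hr0).pow 2)).congr_deriv ?_
    simp only [Pi.pow_apply, Nat.cast_ofNat, Nat.add_one_sub_one, pow_one, R, potential]
    field_simp
    ring
  have hint := intervalIntegral.integral_eq_sub_of_hasDerivAt_of_le zero_le_one
    ((hRc.mul (hu.pow 2)).sub (hP.pow 2)).continuousOn hder
    (Continuous.intervalIntegrable (by fun_prop) 0 1)
  rw [intervalIntegral.integral_sub (Continuous.intervalIntegrable (by fun_prop) 0 1)
    (Continuous.intervalIntegrable (by fun_prop) 0 1), intervalIntegral.integral_const_mul,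
    intervalIntegral.integral_const_mul] at hint
  have h0 : R 0 * radial n b μ 0 ^ 2 = 0 := by
    rcases n.eq_zero_or_pos with rfl | hn
    · simp [R]
    · simp [radial, gauge, hn.ne']
  simp only [Pi.sub_apply, Pi.mul_apply, Pi.pow_apply, h0, hflux, radialFlux_zero] at hint
  simp only [R] at hint
  linear_combination hint

theorem deriv_lowestEigenvalue_formula (n : ℕ) {β : ℝ} (hβ : 0 < β) :
    (∫ r in (0 : ℝ)..1, (-n + (β + β) / 4 * r ^ 2) * (ground n β r * ground n β r * r)) /
        (∫ r in (0 : ℝ)..1, ground n β r * ground n β r * r) =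
      lowestEigenvalue n β / β - 1 / (2 * β) * (lowestEigenvalue n β - ((n : ℝ) - β / 2) ^ 2) *
        (ground n β 1 ^ 2 / ∫ r in (0 : ℝ)..1, ground n β r * ground n β r * r) := by
  have hg := continuous_ground n β
  have hI := (integral_ground_mul_pos n hβ hβ).ne'
  have hv := virial_radial n (radialFlux_lowestEigenvalue n hβ)
  change β ^ 2 * (∫ r in (0 : ℝ)..1, r ^ 2 * (ground n β r * ground n β r * r)) =
    (((n : ℝ) - β / 2) ^ 2 - lowestEigenvalue n β) * ground n β 1 ^ 2
      + 2 * (n * β + lowestEigenvalue n β) *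
        ∫ r in (0 : ℝ)..1, ground n β r * ground n β r * r at hv
  have hsplit : ∫ r in (0 : ℝ)..1, (-n + (β + β) / 4 * r ^ 2) * (ground n β r * ground n β r * r) =
      -n * (∫ r in (0 : ℝ)..1, ground n β r * ground n β r * r)
        + β / 2 * ∫ r in (0 : ℝ)..1, r ^ 2 * (ground n β r * ground n β r * r) := by
    rw [← intervalIntegral.integral_const_mul, ← intervalIntegral.integral_const_mul,
      ← intervalIntegral.integral_add (Continuous.intervalIntegrable (by fun_prop) 0 1)
        (Continuous.intervalIntegrable (by fun_prop) 0 1)]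
    congr 1
    funext r
    ring
  rw [hsplit]
  set I := ∫ r in (0 : ℝ)..1, ground n β r * ground n β r * r
  set K := ∫ r in (0 : ℝ)..1, r ^ 2 * (ground n β r * ground n β r * r)
  have hβ0 := hβ.ne'
  field_simp
  linear_combination 4 * hv

/-! ### Normalization -/

theorem IsEigenfunction.const_mul {n : ℕ} {b μ c : ℝ} {g : ℝ → ℝ} (hg : IsEigenfunction n b μ g)
    (hc : c ≠ 0) : IsEigenfunction n b μ fun r => c * g r where
  continuousOn := continuousOn_const.mul hg.continuousOn
  contDiffOn := contDiffOn_const.mul hg.contDiffOn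
  equation := by
    intro r hr
    have h1 : deriv (fun r => c * g r) = fun r => c * deriv g r := by
      funext x
      simp
    rw [h1, deriv_const_mul_field]
    linear_combination c * hg.equation r hr
  dirichlet_zero := fun hn => by simp [hg.dirichlet_zero hn]
  neumann_zero := fun hn => by simpa using (hg.neumann_zero hn).const_mul c
  neumann_one := by simpa using hg.neumann_one.const_mul c
  nontrivial := by
    obtain ⟨r, hr, hne⟩ := hg.nontrivial
    exact ⟨r, hr, mul_ne_zero hc hne⟩

theorem isEigenfunction_ground (n : ℕ) {b : ℝ} (hb : 0 < b) :
    IsEigenfunction n b (lowestEigenvalue n b) (ground n b) :=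
  isEigenfunction_radial (radialFlux_lowestEigenvalue n hb) (kummer_lowestEigenvalue_pos n hb)

theorem exists_isGroundState (n : ℕ) {b : ℝ} (hb : 0 < b) : ∃ f, IsGroundState n b f := by
  have hI := integral_ground_mul_pos n hb hb
  set I := ∫ r in (0 : ℝ)..1, ground n b r * ground n b r * r with hIdef
  have hs : 0 < Real.sqrt I := Real.sqrt_pos.2 hI
  refine ⟨fun r => (Real.sqrt I)⁻¹ * ground n b r,
    (isEigenfunction_ground n hb).const_mul (inv_pos.2 hs).ne',
    fun r hr => mul_pos (inv_pos.2 hs) (ground_pos n hb hr.1 hr.2.le), ?_⟩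
  have h : ∀ r, ((Real.sqrt I)⁻¹ * ground n b r) ^ 2 * r =
      I⁻¹ * (ground n b r * ground n b r * r) := by
    intro r
    rw [mul_pow, inv_pow, Real.sq_sqrt hI.le]
    ring
  simp only [h]
  rw [intervalIntegral.integral_const_mul, ← hIdef, inv_mul_cancel₀ hI.ne']

/-- By simplicity `f` is a multiple of `ground`, and the normalization fixes the square of the
factor; this is why the formula holds for every normalized ground state. -/
theorem IsGroundState.sq_apply_one {n : ℕ} {b : ℝ} {f : ℝ → ℝ} (hf : IsGroundState n b f)
    (hb : 0 < b) :
    f 1 ^ 2 = ground n b 1 ^ 2 / ∫ r in (0 : ℝ)..1, ground n b r * ground n b r * r := by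
  obtain ⟨c, hc⟩ := hf.eigenfunction.eq_const_mul_radial (kummer_lowestEigenvalue_pos n hb)
    (radialFlux_lowestEigenvalue n hb)
  change ∀ r ∈ Icc (0 : ℝ) 1, f r = c * ground n b r at hc
  have h1 := hf.normalized
  have h2 : ∫ r in (0 : ℝ)..1, f r ^ 2 * r =
      ∫ r in (0 : ℝ)..1, c ^ 2 * (ground n b r * ground n b r * r) := by
    refine intervalIntegral.integral_congr fun r hr => ?_
    rw [uIcc_of_le zero_le_one] at hr
    simp only [hc r hr]
    ring
  rw [h2, intervalIntegral.integral_const_mul] at h1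
  rw [eq_div_iff (integral_ground_mul_pos n hb hb).ne', hc 1 (by simp)]
  linear_combination ground n b 1 ^ 2 * h1

end DiskNeumann

theorem mainTheorem5 (n : ℕ) (β : ℝ) (hβ : 0 < β) :
    IsLeast (DiskNeumann.eigenvalues n β) (DiskNeumann.lowestEigenvalue n β) ∧
    (∃ f : ℝ → ℝ, DiskNeumann.IsGroundState n β f) ∧
    ∀ f : ℝ → ℝ, DiskNeumann.IsGroundState n β f →
      HasDerivAt (fun b : ℝ => DiskNeumann.lowestEigenvalue n b)
        (DiskNeumann.lowestEigenvalue n β / β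
          - 1 / (2 * β) * (DiskNeumann.lowestEigenvalue n β - ((n : ℝ) - β / 2) ^ 2) * |f 1| ^ 2)
        β := by
  refine ⟨DiskNeumann.isLeast_eigenvalues (DiskNeumann.kummer_lowestEigenvalue_pos n hβ)
    (DiskNeumann.radialFlux_lowestEigenvalue n hβ), DiskNeumann.exists_isGroundState n hβ,
    fun f hf => ?_⟩
  rw [sq_abs, hf.sq_apply_one hβ, ← DiskNeumann.deriv_lowestEigenvalue_formula n hβ]
  exact DiskNeumann.hasDerivAt_lowestEigenvalue n hβ
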